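/- Let $K$ be an algebraically closed field that is complete with respect to a nontrivial nonarchimedean absolute value $|\cdot|$, and let $\|x\|=\max_i|x_i|$ on $K^{N+1}$. For $P=(x_0:\dots:x_N)$ and $Q=(y_0:\dots:y_N)$ in $\mathbb{P}^N(K)$ let $$\Delta(P,Q)=\frac{\max_{0\le i,j\le N}|x_iy_j-x_jy_i|}{\|x\|\,\|y\|}$$ be the chordal distance. Let $\varphi:\mathbb{P}^N\to\mathbb{P}^N$ be a morphism of degree $d\ge 2$ over $K$, and let $\Phi=(\Phi_0,\dots,\Phi_N)$ be a lift of $\varphi$, that is, homogeneous polynomials of degree $d$ over $K$ without a common zero in $K^{N+1}\setminus\{0\}$ that give $\varphi$ in homogeneous coordinates. A lift is minimal if all its coefficients have absolute value at most $1$ and at least one has absolute value exactly $1$. Let $\operatorname{Res}(\varphi)$ be a minimal resultant of $\varphi$, that is, the Macaulay resultant of a minimal lift of $\varphi$; here the Macaulay resultant of $N+1$ forms of degree $d$ in $N+1$ variables is the polynomial with integer coefficients in the coefficients of the forms that generates the elimination ideal of the generic forms over $\mathbb{Z}$ (the ideal of those polynomials $a$ in the coefficients such that for every $j$ some $X_j^k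 a$ lies in the ideal generated by the generic forms) and takes the value $1$ at $X_0^d,\dots,X_N^d$. A minimal resultant exists, and every minimal resultant is nonzero. Define $g_\Phi:\mathbb{P}^N(K)\to\mathbb{R}$ by $$g_\Phi(P)=\frac1d\log\|\Phi(x)\|-\log\|x\|$$ for any $x\in K^{N+1}\setminus\{0\}$ representing $P$; this does not depend on the choice of $x$. Then $g_\Phi$ is Lipschitz continuous with respect to the chordal metric. More precisely, for all $P,Q\in\mathbb{P}^N(K)$, $$|g_\Phi(P)-g_\Phi(Q)|\le\frac{\log(|\operatorname{Res}(\varphi)|^{-1})}{d\,|\operatorname{Res}(\varphi)|}\,\Delta(P,Q).$$ Further, $g_\Phi(P)=g_\Phi(Q)$ whenever $\Delta(P,Q)<|\operatorname{Res}(\varphi)|$. In particular, $g_\Phi$ is uniformly locally constant: there is an $\varepsilon>0$ such that $g_\Phi(P)=g_\Phi(Q)$ whenever $\Delta(P,Q)<\varepsilon$. -/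

import Mathlib

open scoped LinearAlgebra.Projectivization

namespace NonarchGreen

noncomputable section

/-! ### The Macaulay resultant of `N + 1` forms of degree `d` in `N + 1` variables -/

section Resultant

/-- The exponent vectors of the monomials of degree `d` in `X_0, …, X_N`. -/
abbrev Mon (N d : ℕ) : Type :=
  {m : Fin (N + 1) →₀ ℕ // m ∈ (Finset.univ : Finset (Fin (N + 1))).finsuppAntidiag d}

/-- The ring `ℤ[c]` of polynomials in the indeterminate coefficients `c_{i,m}` of `N + 1` generic
forms of degree `d` in `N + 1` variables. -/
abbrev CoeffRing (N d : ℕ) : Type := MvPolynomial (Fin (N + 1) × Mon N d) ℤ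

/-- The `i`-th generic form `∑_m c_{i,m} X^m` of degree `d`, an element of `ℤ[c][X_0, …, X_N]`. -/
def genericForm (N d : ℕ) (i : Fin (N + 1)) : MvPolynomial (Fin (N + 1)) (CoeffRing N d) :=
  ∑ m : Mon N d, MvPolynomial.monomial m.1 (MvPolynomial.X (i, m))

/-- The ideal of `ℤ[c][X]` generated by the generic forms. -/
def genericIdeal (N d : ℕ) : Ideal (MvPolynomial (Fin (N + 1)) (CoeffRing N d)) :=
  Ideal.span (Set.range (genericForm N d))

/-- The elimination ideal of the generic forms (inertia forms of degree `0`): all `a ∈ ℤ[c]` such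
that every `X_j` has a power `X_j ^ k` with `X_j ^ k * a` in the ideal of the generic forms. -/
def elimIdeal (N d : ℕ) : Ideal (CoeffRing N d) where
  carrier := {a | ∀ j : Fin (N + 1), ∃ k : ℕ,
    MvPolynomial.X j ^ k * MvPolynomial.C a ∈ genericIdeal N d}
  zero_mem' := fun j => ⟨0, by simp⟩
  add_mem' := by
    intro a b ha hb j
    obtain ⟨k, hk⟩ := ha j
    obtain ⟨l, hl⟩ := hb j
    refine ⟨k + l, ?_⟩
    have h := Ideal.add_mem _ (Ideal.mul_mem_left _ (MvPolynomial.X j ^ l) hk)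
      (Ideal.mul_mem_left _ (MvPolynomial.X j ^ k) hl)
    convert h using 1
    rw [map_add, pow_add]
    ring
  smul_mem' := by
    intro c a ha j
    obtain ⟨k, hk⟩ := ha j
    refine ⟨k, ?_⟩
    have h := Ideal.mul_mem_left _ (MvPolynomial.C c) hk
    convert h using 1
    rw [smul_eq_mul, map_mul]
    ring

/-- The coefficients of the forms `X_0 ^ d, …, X_N ^ d`. -/
def purePowerCoeff (N d : ℕ) (p : Fin (N + 1) × Mon N d) : ℤ :=
  if p.2.1 = Finsupp.single p.1 d then 1 else 0

/-- `R ∈ ℤ[c]` is the Macaulay resultant: it generates the elimination ideal of the generic forms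
and takes the value `1` at the forms `X_0 ^ d, …, X_N ^ d`. -/
def IsMacaulayResultant (N d : ℕ) (R : CoeffRing N d) : Prop :=
  Ideal.span {R} = elimIdeal N d ∧ MvPolynomial.eval (purePowerCoeff N d) R = 1

theorem IsMacaulayResultant.unique {N d : ℕ} {R S : CoeffRing N d}
    (hR : IsMacaulayResultant N d R) (hS : IsMacaulayResultant N d S) : R = S := by
  have h : Associated R S := Ideal.span_singleton_eq_span_singleton.1 (hR.1.trans hS.1.symm)
  obtain ⟨u, rfl⟩ := h
  obtain ⟨c, -, hc⟩ := MvPolynomial.isUnit_iff_eq_C_of_isReduced.1 u.isUnit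
  have h2 := hS.2
  rw [map_mul, hR.2, one_mul, hc, MvPolynomial.eval_C] at h2
  rw [hc, h2, map_one, mul_one]

/-- The Macaulay resultant as a polynomial with integer coefficients in the coefficients of `N + 1`
forms of degree `d`. -/
def resultantPoly (N d : ℕ) : CoeffRing N d :=
  Classical.epsilon (IsMacaulayResultant N d)

/-- The Macaulay resultant `Res(Φ)` of forms `Φ_0, …, Φ_N` of degree `d` over a commutative ring:
the value of the resultant polynomial at the coefficients of the `Φ_i`. -/
def resultant {A : Type*} [CommRing A] {N : ℕ} (d : ℕ)
    (Φ : Fin (N + 1) → MvPolynomial (Fin (N + 1)) A) : A :=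
  MvPolynomial.aeval (fun p : Fin (N + 1) × Mon N d => (Φ p.1).coeff p.2.1) (resultantPoly N d)

end Resultant

section Projective

variable {K : Type*} [NontriviallyNormedField K] {N : ℕ}

/-- The chordal distance on `ℙ^N(K)`. The norm of `Fin (N + 1) → K` is the sup norm, and the
iterated supremum is the maximum over the finitely many pairs of indices. By `chordalDist_mk` any
lifts of the two points may be used. -/
def chordalDist (P Q : ℙ K (Fin (N + 1) → K)) : ℝ :=
  (⨆ p : Fin (N + 1) × Fin (N + 1), ‖P.rep p.1 * Q.rep p.2 - P.rep p.2 * Q.rep p.1‖) /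
    (‖P.rep‖ * ‖Q.rep‖)

theorem chordalDist_mk (x y : Fin (N + 1) → K) (hx : x ≠ 0) (hy : y ≠ 0) :
    chordalDist (Projectivization.mk K x hx) (Projectivization.mk K y hy) =
      (⨆ p : Fin (N + 1) × Fin (N + 1), ‖x p.1 * y p.2 - x p.2 * y p.1‖) / (‖x‖ * ‖y‖) := by
  obtain ⟨a, ha⟩ := Projectivization.exists_smul_eq_mk_rep K x hx
  obtain ⟨b, hb⟩ := Projectivization.exists_smul_eq_mk_rep K y hy
  have ha0 : ‖(a : K)‖ ≠ 0 := norm_ne_zero_iff.2 a.ne_zero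
  have hb0 : ‖(b : K)‖ ≠ 0 := norm_ne_zero_iff.2 b.ne_zero
  unfold chordalDist
  rw [← ha, ← hb]
  have h : ∀ p : Fin (N + 1) × Fin (N + 1),
      ‖(a • x) p.1 * (b • y) p.2 - (a • x) p.2 * (b • y) p.1‖ =
        (‖(a : K)‖ * ‖(b : K)‖) * ‖x p.1 * y p.2 - x p.2 * y p.1‖ := by
    intro p
    rw [← norm_mul, ← norm_mul]
    congr 1
    simp only [Pi.smul_apply, Units.smul_def, smul_eq_mul]
    ring
  simp_rw [h]
  rw [← Real.mul_iSup_of_nonneg (by positivity), Units.smul_def, Units.smul_def, norm_smul,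
    norm_smul, mul_mul_mul_comm, mul_div_mul_left _ _ (mul_ne_zero ha0 hb0)]

/-- The map `K^{N+1} → K^{N+1}` given by the polynomials `Φ_0, …, Φ_N`. -/
def polyMap (Φ : Fin (N + 1) → MvPolynomial (Fin (N + 1)) K) (x : Fin (N + 1) → K) :
    Fin (N + 1) → K :=
  fun i => MvPolynomial.eval x (Φ i)

/-- `Φ` is a lift of the self-map `φ` of `ℙ^N(K)`, and `φ` is a morphism of degree `d`: the `Φ_i`
are forms of degree `d` without a common zero other than `0`, and they give `φ` in homogeneous
coordinates. -/
structure IsLift (d : ℕ) (φ : ℙ K (Fin (N + 1) → K) → ℙ K (Fin (N + 1) → K))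
    (Φ : Fin (N + 1) → MvPolynomial (Fin (N + 1)) K) : Prop where
  isHomogeneous : ∀ i, (Φ i).IsHomogeneous d
  ne_zero : ∀ x : Fin (N + 1) → K, x ≠ 0 → polyMap Φ x ≠ 0
  map_mk : ∀ (x : Fin (N + 1) → K) (hx : x ≠ 0),
    φ (Projectivization.mk K x hx) = Projectivization.mk K (polyMap Φ x) (ne_zero x hx)

/-- `φ` is (the map on `K`-points of) a morphism `ℙ^N → ℙ^N` of degree `d`. -/
def IsMorphismOfDegree (d : ℕ) (φ : ℙ K (Fin (N + 1) → K) → ℙ K (Fin (N + 1) → K)) : Prop :=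
  ∃ Φ, IsLift d φ Φ

/-- A minimal lift: all coefficients are integral and at least one of them is a unit. -/
structure IsMinimalLift (d : ℕ) (φ : ℙ K (Fin (N + 1) → K) → ℙ K (Fin (N + 1) → K))
    (Φ : Fin (N + 1) → MvPolynomial (Fin (N + 1)) K) : Prop extends IsLift d φ Φ where
  integral : ∀ i m, ‖(Φ i).coeff m‖ ≤ 1
  exists_unit : ∃ i m, ‖(Φ i).coeff m‖ = 1

/-- `ρ` is a minimal resultant of `φ`: the resultant of some minimal lift of `φ`. -/
def IsMinimalResultant (d : ℕ) (φ : ℙ K (Fin (N + 1) → K) → ℙ K (Fin (N + 1) → K)) (ρ : K) :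
    Prop :=
  ∃ Ψ, IsMinimalLift d φ Ψ ∧ ρ = resultant d Ψ

/-- The function `g_Φ(P) = (1/d) log ‖Φ(x)‖ - log ‖x‖` on `ℙ^N(K)`, where `x` is a lift of `P`. -/
def gFun (d : ℕ) (Φ : Fin (N + 1) → MvPolynomial (Fin (N + 1)) K)
    (P : ℙ K (Fin (N + 1) → K)) : ℝ :=
  1 / (d : ℝ) * Real.log ‖polyMap Φ P.rep‖ - Real.log ‖P.rep‖

end Projective

end

end NonarchGreen

/-!
Let `Ψ` be a minimal lift and `R = Res(Ψ)`. The resultant polynomial lies in the elimination ideal,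
so specializing the generic forms to `Ψ` gives identities `X_j ^ k * R = ∑ i, h_i * Ψ_i` with
integral `h_i`, whence `|R| ≤ ‖Ψ(x)‖ ≤ 1` on the unit sphere. Two points at chordal distance
`δ < 1` have representatives on the unit sphere at distance at most `δ`, and integral polynomials
are `1`-Lipschitz on the unit ball; so if `δ < |R|`, then `‖Ψ(x) - Ψ(y)‖ < ‖Ψ(x)‖` and the
ultrametric inequality gives `‖Ψ(x)‖ = ‖Ψ(y)‖`. If `δ ≥ |R|`, the Lipschitz estimate follows from
`log |R| / d ≤ g_Ψ ≤ 0`. Two lifts differ by a constant factor, because multiplication by their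
ratio preserves the finite-dimensional space of forms of a large degree, so that the ratio is
algebraic over `K`.

It remains to see that the elimination ideal is principal. Solving the generic equations `F_i = 0`
for the coefficients of the `X_j ^ d` shows that it is prime. It vanishes on any family of forms
with a common zero. There is such a one-parameter family in which the leading terms of all
coefficients but that of `X_0 ^ d` in `F_0` are generic; these coefficients are then algebraically
independent, so no nonzero element of the ideal is free of the remaining one. A prime ideal of
`A[T]`, `A` factorial, that meets `A` in `0` is principal.
-/

namespace NonarchGreen

open MvPolynomial

theorem exists_det_submatrix_ne_zero {ι κ k : Type*} [Fintype ι] [DecidableEq ι] [Fintype κ]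
    [Field k] {M : Matrix ι κ k} (hM : Function.Surjective M.mulVec) :
    ∃ f : ι → κ, (M.submatrix id f).det ≠ 0 := by
  obtain ⟨κ', f, -, hspan, hli⟩ := exists_linearIndependent' k M.col
  have htop : ⊤ ≤ Submodule.span k (Set.range (M.col ∘ f)) := by
    rw [hspan, ← Matrix.range_mulVecLin, LinearMap.range_eq_top.2 hM]
  let e := (Pi.basisFun k ι).indexEquiv (Module.Basis.mk hli htop)
  refine ⟨f ∘ e, ?_⟩
  rw [← isUnit_iff_ne_zero, ← Matrix.isUnit_iff_isUnit_det,
    ← Matrix.linearIndependent_cols_iff_isUnit]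
  exact hli.comp e e.injective

theorem exists_ne_zero_and_smul_mem_range_mulVec {ι κ R k : Type*} [Finite ι] [Fintype κ]
    [CommRing R] [Field k] (φ : R →+* k) (M : Matrix ι κ R)
    (hM : Function.Surjective (M.map φ).mulVec) :
    ∃ a : R, φ a ≠ 0 ∧ ∀ u, a • u ∈ Set.range M.mulVec := by
  classical
  cases nonempty_fintype ι
  obtain ⟨f, hf⟩ := exists_det_submatrix_ne_zero hM
  let A := M.submatrix id f
  have hA : A = M * (1 : Matrix κ κ R).submatrix id f := by
    simpa using (Matrix.submatrix_mul M 1 id id f Function.bijective_id)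
  refine ⟨A.det, by rwa [φ.map_det], fun u =>
    ⟨(1 : Matrix κ κ R).submatrix id f |>.mulVec (A.adjugate.mulVec u), ?_⟩⟩
  rw [Matrix.mulVec_mulVec, ← hA, Matrix.mulVec_mulVec, A.mul_adjugate, Matrix.smul_mulVec,
    Matrix.one_mulVec]

theorem isPrincipal_of_comap_C_eq_bot {A : Type*} [CommRing A] [IsDomain A]
    [UniqueFactorizationMonoid A] (p : Ideal (Polynomial A)) [p.IsPrime]
    (h : p.comap Polynomial.C = ⊥) : p.IsPrincipal := by
  by_cases hp : p = ⊥
  · exact hp ▸ bot_isPrincipal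
  obtain ⟨f, hfp, hf⟩ := Ideal.IsPrime.exists_mem_prime_of_ne_bot ‹_› hp
  have hfle : Ideal.span {f} ≤ p := (Ideal.span_singleton_le_iff_mem _).2 hfp
  have : (Ideal.span {f}).IsPrime := (Ideal.span_singleton_prime hf.ne_zero).2 hf
  let S := (nonZeroDivisors A).map (Polynomial.C : A →+* Polynomial A)
  let F := Polynomial (FractionRing A)
  algebraize [Polynomial.mapRingHom (algebraMap A (FractionRing A))]
  have : IsLocalization S F := Polynomial.isLocalization _ _
  have hdisj : Disjoint (S : Set (Polynomial A)) p := by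
    rw [Set.disjoint_left]
    rintro _ ⟨c, hc, rfl⟩ hcp
    have hc0 : c ∈ p.comap Polynomial.C := hcp
    rw [h, Ideal.mem_bot] at hc0
    exact nonZeroDivisors.ne_zero hc hc0
  have hdisj' : Disjoint (S : Set (Polynomial A)) (Ideal.span {f}) := hdisj.mono_right hfle
  have hprime := IsLocalization.isPrime_of_isPrime_disjoint S F _ ‹_› hdisj
  have hprime' := IsLocalization.isPrime_of_isPrime_disjoint S F _ ‹_› hdisj'
  have hinj : Function.Injective (algebraMap (Polynomial A) F) :=
    Polynomial.map_injective _ (IsFractionRing.injective A _)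
  have hmap : (Ideal.span {f}).map (algebraMap _ F) = p.map (algebraMap _ F) := by
    refine (hprime'.isMaximal ?_).eq_of_le hprime.ne_top (Ideal.map_mono hfle)
    rw [Ne, Ideal.map_eq_bot_iff_of_injective hinj, Ideal.span_singleton_eq_bot]
    exact hf.ne_zero
  refine ⟨f, ?_⟩
  rw [← IsLocalization.under_map_of_isPrime_disjoint S F ‹_› hdisj, ← hmap,
    IsLocalization.under_map_of_isPrime_disjoint S F ‹_› hdisj']

theorem isPrincipal_of_rename_mem_imp {σ R : Type*} [CommRing R] [IsDomain R]
    [UniqueFactorizationMonoid R] (p : Ideal (MvPolynomial σ R)) [p.IsPrime] (a : σ)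
    (h : ∀ P : MvPolynomial {b // b ≠ a} R, rename (↑) P ∈ p → P = 0) : p.IsPrincipal := by
  classical
  let e : MvPolynomial σ R ≃ₐ[R] Polynomial (MvPolynomial {b // b ≠ a} R) :=
    (renameEquiv R (Equiv.optionSubtypeNe a).symm).trans (optionEquivLeft R _)
  have he (P : MvPolynomial {b // b ≠ a} R) : e.symm (Polynomial.C P) = rename (↑) P := by
    refine DFunLike.congr_fun (f := e.symm.toAlgHom.comp Polynomial.CAlgHom)
      (algHom_ext fun b => ?_) P
    simp [e]
  have := isPrincipal_of_comap_C_eq_bot (p.comap e.symm) <|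
    (Submodule.eq_bot_iff _).2 fun P hP => h P <| by rwa [← he]
  exact Ideal.IsPrincipal.of_comap e.symm e.symm.surjective p

section Degeneration

variable {σ R B : Type*} [CommRing R] [CommRing B] [Algebra R B]

theorem exists_eq_X_pow_mul_and_coeff_zero_ne_zero {P : Polynomial R} (hP : P ≠ 0) :
    ∃ (r : ℕ) (Q : Polynomial R), P = Polynomial.X ^ r * Q ∧ Q.coeff 0 ≠ 0 := by
  obtain ⟨Q, hQ, hndvd⟩ := P.exists_eq_pow_rootMultiplicity_mul_and_not_dvd hP 0
  rw [Polynomial.C_0, sub_zero] at hQ hndvd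
  exact ⟨_, Q, hQ, mt Polynomial.X_dvd_iff.2 hndvd⟩

theorem algebraicIndependent_X_pow_mul (w : σ → ℕ) {h : σ → Polynomial B}
    (hh : AlgebraicIndependent R fun p => (h p).coeff 0) :
    AlgebraicIndependent R fun p => (Polynomial.X ^ w p * h p : Polynomial B) := by
  rw [algebraicIndependent_iff] at hh ⊢
  intro P hP
  by_contra hP0
  let scale : MvPolynomial σ R →ₐ[R] Polynomial (MvPolynomial σ R) :=
    aeval fun p => Polynomial.X ^ w p * Polynomial.C (X p)
  let spec : Polynomial (MvPolynomial σ R) →ₐ[R] Polynomial B :=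
    Polynomial.aevalTower (aeval h) Polynomial.X
  have coeff_spec (Q : Polynomial (MvPolynomial σ R)) :
      (spec Q).coeff 0 = aeval (fun p => (h p).coeff 0) (Q.coeff 0) := by
    refine DFunLike.congr_fun (f := Polynomial.constantCoeff.comp spec.toRingHom)
      (g := (aeval fun p => (h p).coeff 0).toRingHom.comp Polynomial.constantCoeff)
      (Polynomial.ringHom_ext' (ringHom_ext (fun r => ?_) fun p => ?_) ?_) Q
    all_goals simp [spec, Polynomial.algebraMap_apply]
  have spec_scale : spec.comp scale = aeval fun p => Polynomial.X ^ w p * h p :=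
    algHom_ext fun p => by simp [spec, scale, Polynomial.X_pow_mul]
  have eval_one_scale : (Polynomial.aevalTower (AlgHom.id R _) 1).comp scale = AlgHom.id R _ :=
    algHom_ext fun p => by simp [scale]
  have hscale : scale P ≠ 0 := fun h0 => hP0 <| by
    simpa [h0] using (DFunLike.congr_fun eval_one_scale P).symm
  obtain ⟨r, Q, hQ, hQ0⟩ := exists_eq_X_pow_mul_and_coeff_zero_ne_zero hscale
  have hspecQ : spec Q = 0 := by
    have h0 : spec (scale P) = 0 := (DFunLike.congr_fun spec_scale P).trans hP
    rw [hQ, map_mul, map_pow, Polynomial.aevalTower_X, mul_comm] at h0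
    exact (Polynomial.monic_X_pow r).mul_left_eq_zero_iff.1 h0
  exact hQ0 (hh _ (by rw [← coeff_spec, hspecQ, Polynomial.coeff_zero]))

theorem isPrincipal_of_degeneration [IsDomain R] [UniqueFactorizationMonoid R]
    (p : Ideal (MvPolynomial σ R)) [p.IsPrime] (a : σ) {c : σ → B} (hc : AlgebraicIndependent R c)
    {w : σ → ℕ} {h : σ → Polynomial B} (hh : ∀ b ≠ a, (h b).coeff 0 = c b)
    (hp : ∀ P ∈ p, aeval (fun b => Polynomial.X ^ w b * h b) P = 0) : p.IsPrincipal := by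
  refine isPrincipal_of_rename_mem_imp p a fun P hP => ?_
  have hcoeff : c ∘ Subtype.val = fun b : {b // b ≠ a} => (h b).coeff 0 :=
    funext fun b => (hh b b.2).symm
  have hind := algebraicIndependent_X_pow_mul (fun b : {b // b ≠ a} => w b)
    (hcoeff ▸ hc.comp _ Subtype.val_injective)
  refine algebraicIndependent_iff.1 hind P ?_
  rw [← hp _ hP, aeval_rename, Function.comp_def]

end Degeneration

section IdealsOfForms

variable {σ ι R : Type*} [CommRing R]

theorem exists_forall_isHomogeneous_mem [Finite σ] {I : Ideal (MvPolynomial σ R)}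
    (hI : ∀ j, X j ∈ I.radical) :
    ∃ n, ∀ m ≥ n, ∀ P : MvPolynomial σ R, P.IsHomogeneous m → P ∈ I := by
  obtain ⟨n, hn⟩ := Ideal.exists_pow_le_of_le_radical_of_fg
    (Ideal.span_le.2 (Set.range_subset_iff.2 hI)) (idealOfVars_fg σ R)
  refine ⟨n, fun m hm P hP => hn ((mem_pow_idealOfVars_iff' n P).2 fun e he => ?_)⟩
  exact hP.coeff_eq_zero (he.trans_le hm).ne

attribute [local instance] MvPolynomial.gradedAlgebra in
theorem homogeneousComponent_add_mul {P Q : MvPolynomial σ R} {n d : ℕ}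
    (hQ : Q.IsHomogeneous d) :
    homogeneousComponent (n + d) (P * Q) = homogeneousComponent n P * Q := by
  simpa only [DirectSum.decompose, Equiv.coe_fn_mk, decomposition.decompose'_apply] using
    DirectSum.coe_decompose_mul_add_of_right_mem (homogeneousSubmodule σ R) (i := n) (a := P) hQ

theorem exists_isHomogeneous_sum_mul_eq [Fintype ι] {Ψ : ι → MvPolynomial σ R} {n d : ℕ}
    (hΨ : ∀ i, (Ψ i).IsHomogeneous d) {P : MvPolynomial σ R} (hP : P.IsHomogeneous (n + d))
    (hmem : P ∈ Ideal.span (Set.range Ψ)) :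
    ∃ h : ι → MvPolynomial σ R, (∀ i, (h i).IsHomogeneous n) ∧ ∑ i, h i * Ψ i = P := by
  obtain ⟨h, rfl⟩ := Ideal.mem_span_range_iff_exists_fun.1 hmem
  refine ⟨fun i => homogeneousComponent n (h i),
    fun i => homogeneousComponent_isHomogeneous _ _, ?_⟩
  rw [← homogeneousComponent_eq_self hP, map_sum]
  exact Finset.sum_congr rfl fun i _ => (homogeneousComponent_add_mul (hΨ i)).symm

theorem exists_eq_smul_of_mul_eq_mul {k : Type*} [Field k] [IsAlgClosed k] [Finite σ] [Nonempty σ]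
    [Finite ι] {Φ Ψ : ι → MvPolynomial σ k} {d : ℕ} (hΦ : ∀ i, (Φ i).IsHomogeneous d)
    (hΨ : ∀ i, (Ψ i).IsHomogeneous d) (hX : ∀ j, X j ∈ (Ideal.span (Set.range Ψ)).radical)
    (hΨ0 : Ψ ≠ 0) (hcross : ∀ i l, Φ i * Ψ l = Φ l * Ψ i) : ∃ c : k, Φ = c • Ψ := by
  cases nonempty_fintype ι
  obtain ⟨l, hl⟩ := Function.ne_iff.1 hΨ0
  let F := FractionRing (MvPolynomial σ k)
  let toF : MvPolynomial σ k →ₐ[k] F := IsScalarTower.toAlgHom k _ F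
  have hinj : Function.Injective toF := IsFractionRing.injective _ F
  let h : F := toF (Φ l) / toF (Ψ l)
  have hmul i : h * toF (Ψ i) = toF (Φ i) := by
    rw [div_mul_eq_mul_div, div_eq_iff ((map_ne_zero_iff toF hinj).2 hl), ← map_mul,
      ← map_mul, hcross]
  obtain ⟨n, hn⟩ := exists_forall_isHomogeneous_mem hX
  have hint : IsIntegral k h := by
    refine isIntegral_of_smul_mem_submodule ((homogeneousSubmodule σ k (n + d)).map toF.toLinearMap)
      ?_ ((homogeneousSubmodule_fg σ k _).map _) h ?_
    · obtain ⟨j⟩ := ‹Nonempty σ›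
      exact (Submodule.ne_bot_iff _).2 ⟨toF (X j ^ (n + d)), ⟨_, isHomogeneous_X_pow j _, rfl⟩,
        (map_ne_zero_iff toF hinj).2 (pow_ne_zero _ (X_ne_zero j))⟩
    · rintro _ ⟨P, hP, rfl⟩
      obtain ⟨g, hg, rfl⟩ :=
        exists_isHomogeneous_sum_mul_eq hΨ hP (hn _ (Nat.le_add_right n d) P hP)
      refine ⟨∑ i, g i * Φ i, IsHomogeneous.sum _ _ _ fun i _ => (hg i).mul (hΦ i), ?_⟩
      simp only [AlgHom.toLinearMap_apply, map_sum, map_mul, smul_eq_mul, ← hmul, Finset.mul_sum,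
        mul_left_comm]
  obtain ⟨c, hc⟩ := minpoly.mem_range_of_degree_eq_one k h
    (IsAlgClosed.degree_eq_one_of_irreducible k (minpoly.irreducible hint))
  refine ⟨c, funext fun i => hinj ?_⟩
  rw [← hmul, ← hc, Pi.smul_apply, map_smul, Algebra.smul_def]

end IdealsOfForms

section Forms

variable {A B : Type*} [CommRing A] [CommRing B] {N n d : ℕ}

theorem mem_finsuppAntidiag_univ {n d : ℕ} {m : Fin n →₀ ℕ} :
    m ∈ (Finset.univ : Finset (Fin n)).finsuppAntidiag d ↔ m.degree = d := by
  simp [Finset.mem_finsuppAntidiag, Finsupp.degree_eq_sum]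

theorem Mon.degree_eq (m : Mon N n) : m.1.degree = n :=
  mem_finsuppAntidiag_univ.1 m.2

/-- The form of degree `n` in `X_0, …, X_N` with prescribed coefficients. -/
noncomputable def form (v : Mon N n → A) : MvPolynomial (Fin (N + 1)) A :=
  ∑ m, monomial m.1 (v m)

theorem isHomogeneous_form (v : Mon N n → A) : (form v).IsHomogeneous n :=
  IsHomogeneous.sum _ _ _ fun m _ => isHomogeneous_monomial _ m.degree_eq

@[simp]
theorem coeff_form (v : Mon N n → A) (m : Mon N n) : (form v).coeff m.1 = v m := by
  classical
  simp [form, coeff_sum, coeff_monomial]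

theorem form_eq_of_isHomogeneous {P : MvPolynomial (Fin (N + 1)) A} (hP : P.IsHomogeneous n)
    {v : Mon N n → A} (hv : ∀ m, v m = P.coeff m.1) : form v = P := by
  ext m
  by_cases hm : m.degree = n
  · exact (coeff_form v ⟨m, mem_finsuppAntidiag_univ.2 hm⟩).trans (hv _)
  · rw [(isHomogeneous_form v).coeff_eq_zero hm, hP.coeff_eq_zero hm]

theorem form_coeff {P : MvPolynomial (Fin (N + 1)) A} (hP : P.IsHomogeneous n) :
    form (fun m : Mon N n => P.coeff m.1) = P :=
  form_eq_of_isHomogeneous hP fun _ => rfl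

theorem map_form (f : A →+* B) (v : Mon N n → A) : map f (form v) = form (f ∘ v) := by
  simp [form, map_monomial]

theorem form_smul (a : A) (v : Mon N n → A) : form (a • v) = C a * form v := by
  simp [form, Finset.mul_sum, C_mul_monomial]

theorem isHomogeneous_genericForm (i : Fin (N + 1)) : (genericForm N d i).IsHomogeneous d :=
  isHomogeneous_form _

/-- The specialization of the coefficients of the generic forms to the values `γ`. -/
noncomputable def specialize (γ : Fin (N + 1) × Mon N d → A) : CoeffRing N d →+* A :=
  (aeval γ : CoeffRing N d →ₐ[ℤ] A).toRingHom

@[simp]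
theorem specialize_X (γ : Fin (N + 1) × Mon N d → A) (p : Fin (N + 1) × Mon N d) :
    specialize γ (X p) = γ p :=
  aeval_X γ p

theorem map_specialize_genericForm (γ : Fin (N + 1) × Mon N d → A) (i : Fin (N + 1)) :
    map (specialize γ) (genericForm N d i) = form fun m => γ (i, m) := by
  rw [genericForm, ← form, map_form]
  simp only [Function.comp_def, specialize_X]

/-- The Macaulay matrix of `Ψ_0, …, Ψ_N` in degree `n + d`: its column `(i, q)` consists of the
coefficients of the form `X^q Ψ_i`. -/
noncomputable def macaulayMatrix (n d : ℕ) (Ψ : Fin (N + 1) → MvPolynomial (Fin (N + 1)) A) :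
    Matrix (Mon N (n + d)) (Fin (N + 1) × Mon N n) A :=
  Matrix.of fun m q => (monomial q.2.1 1 * Ψ q.1).coeff m.1

theorem macaulayMatrix_map (f : A →+* B) (Ψ : Fin (N + 1) → MvPolynomial (Fin (N + 1)) A) :
    (macaulayMatrix n d Ψ).map f = macaulayMatrix n d fun i => map f (Ψ i) := by
  ext m q
  simp [macaulayMatrix, ← coeff_map]

theorem form_macaulayMatrix_mulVec {Ψ : Fin (N + 1) → MvPolynomial (Fin (N + 1)) A}
    (hΨ : ∀ i, (Ψ i).IsHomogeneous d) (v : Fin (N + 1) × Mon N n → A) :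
    form ((macaulayMatrix n d Ψ).mulVec v) = ∑ i, form (fun q => v (i, q)) * Ψ i := by
  refine form_eq_of_isHomogeneous
    (IsHomogeneous.sum _ _ _ fun i _ => (isHomogeneous_form _).mul (hΨ i)) fun m => ?_
  have hcol (i) (q : Mon N n) : macaulayMatrix n d Ψ m (i, q) * v (i, q) =
      (monomial q.1 (v (i, q)) * Ψ i).coeff m.1 := by
    rw [← mul_one (v (i, q)), ← C_mul_monomial, mul_assoc, coeff_C_mul, mul_one, mul_comm]
    rfl
  simp only [Matrix.mulVec, dotProduct, Fintype.sum_prod_type, hcol, form, Finset.sum_mul,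
    coeff_sum]

theorem macaulayMatrix_mulVec_surjective {Ψ : Fin (N + 1) → MvPolynomial (Fin (N + 1)) A}
    (hΨ : ∀ i, (Ψ i).IsHomogeneous d)
    (h : ∀ P : MvPolynomial (Fin (N + 1)) A, P.IsHomogeneous (n + d) →
      P ∈ Ideal.span (Set.range Ψ)) :
    Function.Surjective (macaulayMatrix n d Ψ).mulVec := by
  intro u
  have hu := isHomogeneous_form u
  obtain ⟨g, hg, hsum⟩ := exists_isHomogeneous_sum_mul_eq hΨ hu (h _ hu)
  refine ⟨fun q => (g q.1).coeff q.2.1, funext fun m => ?_⟩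
  rw [← coeff_form (Matrix.mulVec _ _) m, form_macaulayMatrix_mulVec hΨ]
  simp only [form_coeff (hg _), hsum, coeff_form]

end Forms

section EliminationIdeal

variable {N d : ℕ}

/-- The polynomial ring `ℤ[c][X_0, …, X_N]` of the generic forms. -/
abbrev FormRing (N d : ℕ) : Type :=
  MvPolynomial (Fin (N + 1)) (CoeffRing N d)

theorem exists_mem_elimIdeal_specialize_ne_zero {k : Type*} [Field k]
    {γ : Fin (N + 1) × Mon N d → k}
    (hγ : ∀ j, X j ∈ (Ideal.span (Set.range fun i => form fun m => γ (i, m))).radical) :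
    ∃ a ∈ elimIdeal N d, specialize γ a ≠ 0 := by
  obtain ⟨n, hn⟩ := exists_forall_isHomogeneous_mem hγ
  obtain ⟨a, ha, hrange⟩ := exists_ne_zero_and_smul_mem_range_mulVec
    (specialize γ) (macaulayMatrix n d (genericForm N d)) <| by
      simp only [macaulayMatrix_map, map_specialize_genericForm]
      exact macaulayMatrix_mulVec_surjective (fun i => isHomogeneous_form _) (hn _ (by simp))
  refine ⟨a, fun j => ⟨n + d, ?_⟩, ha⟩
  obtain ⟨v, hv⟩ := hrange fun m => (X j ^ (n + d) : FormRing N d).coeff m.1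
  rw [mul_comm, ← form_coeff (isHomogeneous_X_pow j (n + d)), ← form_smul, ← hv,
    form_macaulayMatrix_mulVec isHomogeneous_genericForm]
  exact Ideal.sum_mem _ fun i _ => Ideal.mul_mem_left _ _ (Ideal.subset_span ⟨i, rfl⟩)

theorem specialize_eq_zero_of_mem_elimIdeal {B : Type*} [CommRing B] {a : CoeffRing N d}
    (ha : a ∈ elimIdeal N d) {γ : Fin (N + 1) × Mon N d → B} {x : Fin (N + 1) → B}
    (hx : ∃ j, x j ∈ nonZeroDivisors B) (hγ : ∀ i, eval x (form fun m => γ (i, m)) = 0) :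
    specialize γ a = 0 := by
  obtain ⟨j, hj⟩ := hx
  obtain ⟨k, hk⟩ := ha j
  let f : FormRing N d →+* B := (eval x).comp (map (specialize γ))
  have hf : genericIdeal N d ≤ RingHom.ker f := by
    rw [genericIdeal, Ideal.span_le]
    rintro _ ⟨i, rfl⟩
    exact (congrArg (eval x) (map_specialize_genericForm γ i)).trans (hγ i)
  have h0 : x j ^ k * specialize γ a = 0 := by
    rw [← hf hk]
    simp only [f, RingHom.comp_apply, map_mul, map_pow, map_X, map_C, eval_X, eval_C]
  exact (mul_left_mem_nonZeroDivisors_eq_zero_iff (pow_mem hj k)).1 h0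

end EliminationIdeal

/-- The exponent vector of `X_j ^ d`. -/
noncomputable def Mon.pure {N : ℕ} (d : ℕ) (j : Fin (N + 1)) : Mon N d :=
  ⟨Finsupp.single j d, mem_finsuppAntidiag_univ.2 (by simp)⟩

section SolveAt

variable {N d : ℕ} (j : Fin (N + 1))

/-- The ring `ℤ[c][X_0, …, X_N]` with `X_j` inverted. -/
abbrev FormRingAway (N d : ℕ) (j : Fin (N + 1)) : Type :=
  Localization.Away (X j : FormRing N d)

instance : IsDomain (FormRingAway N d j) :=
  IsLocalization.isDomain_localization
    (powers_le_nonZeroDivisors_of_noZeroDivisors (X_ne_zero j))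

/-- The inclusion of `ℤ[c][X_0, …, X_N]` into its localization at `X_j`. -/
noncomputable abbrev toAway (N d : ℕ) (j : Fin (N + 1)) : FormRing N d →+* FormRingAway N d j :=
  algebraMap _ _

theorem toAway_X_ne_zero (i : Fin (N + 1)) : toAway N d j (X i) ≠ 0 :=
  (map_ne_zero_iff _ (IsLocalization.injective _
    (powers_le_nonZeroDivisors_of_noZeroDivisors (X_ne_zero j)))).2 (X_ne_zero i)

open Classical in
/-- The retraction of `ℤ[c][X, X_j⁻¹]` onto its quotient by the generic forms, restricted to
`ℤ[c][X]`: the equations `F_i = 0` are solved for the coefficients of the `X_j ^ d`, so that the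
coefficient of `X_j ^ d` in `F_i` is replaced with itself minus `F_i / X_j ^ d`. -/
noncomputable def solveAt (N d : ℕ) (j : Fin (N + 1)) : FormRing N d →+* FormRingAway N d j :=
  eval₂Hom (specialize fun p => toAway N d j (C (X p)) -
      if p.2 = Mon.pure d j then
        toAway N d j (genericForm N d p.1) *
          IsLocalization.Away.invSelf (X j : FormRing N d) ^ d
      else 0)
    fun i => toAway N d j (X i)

@[simp]
theorem solveAt_X (i : Fin (N + 1)) : solveAt N d j (X i) = toAway N d j (X i) :=
  eval₂_X _ _ _

open Classical in
theorem solveAt_C_X (p : Fin (N + 1) × Mon N d) :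
    solveAt N d j (C (X p)) = toAway N d j (C (X p)) - if p.2 = Mon.pure d j then
      toAway N d j (genericForm N d p.1) *
        IsLocalization.Away.invSelf (X j : FormRing N d) ^ d
    else 0 := by
  rw [solveAt, coe_eval₂Hom, eval₂_C, specialize_X]

theorem solveAt_monomial_one (m : Fin (N + 1) →₀ ℕ) :
    solveAt N d j (monomial m 1) = toAway N d j (monomial m 1) := by
  simp only [monomial_eq, C_1, one_mul, Finsupp.prod, map_prod, map_pow, solveAt_X]

theorem solveAt_genericForm (i : Fin (N + 1)) : solveAt N d j (genericForm N d i) = 0 := by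
  classical
  have hpure : IsLocalization.Away.invSelf (X j : FormRing N d) ^ d *
      toAway N d j (monomial (Mon.pure d j).1 1) = 1 := by
    rw [Mon.pure, ← X_pow_eq_monomial, map_pow, ← mul_pow, mul_comm,
      IsLocalization.Away.mul_invSelf, one_pow]
  have hF : genericForm N d i = ∑ m : Mon N d, C (X (i, m)) * monomial m.1 1 := by
    simp only [genericForm, C_mul_monomial, mul_one]
  calc solveAt N d j (genericForm N d i)
      = ∑ m : Mon N d, solveAt N d j (C (X (i, m))) * toAway N d j (monomial m.1 1) := by
        simp only [hF, map_sum, map_mul, solveAt_monomial_one]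
    _ = toAway N d j (genericForm N d i) - toAway N d j (genericForm N d i) *
          (IsLocalization.Away.invSelf (X j : FormRing N d) ^ d *
            toAway N d j (monomial (Mon.pure d j).1 1)) := by
        simp only [solveAt_C_X, sub_mul, Finset.sum_sub_distrib, ite_mul, zero_mul,
          Finset.sum_ite_eq', Finset.mem_univ, if_true, mul_assoc]
        simp only [← map_mul, ← map_sum, ← hF]
    _ = 0 := by rw [hpure, mul_one, sub_self]

theorem toAway_sub_solveAt_mem (t : FormRing N d) :
    toAway N d j t - solveAt N d j t ∈ (genericIdeal N d).map (toAway N d j) := by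
  let π := Ideal.Quotient.mk ((genericIdeal N d).map (toAway N d j))
  have hπ : π.comp (toAway N d j) = π.comp (solveAt N d j) := by
    refine ringHom_ext' (ringHom_ext' (RingHom.ext_int _ _) fun p => ?_) fun i => ?_
    · have hF : π (toAway N d j (genericForm N d p.1)) = 0 :=
        Ideal.Quotient.eq_zero_iff_mem.2 (Ideal.mem_map_of_mem _ (Ideal.subset_span ⟨p.1, rfl⟩))
      simp only [RingHom.comp_apply, solveAt_C_X, map_sub]
      split_ifs <;> simp only [map_mul, hF, zero_mul, map_zero, sub_zero]
    · simp only [RingHom.comp_apply, solveAt_X]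
  exact Ideal.Quotient.eq.1 (DFunLike.congr_fun hπ t)

theorem solveAt_eq_zero_iff (t : FormRing N d) :
    solveAt N d j t = 0 ↔ ∃ k : ℕ, X j ^ k * t ∈ genericIdeal N d := by
  constructor
  · intro h
    have hmem := toAway_sub_solveAt_mem j t
    rw [h, sub_zero, IsLocalization.algebraMap_mem_map_algebraMap_iff (Submonoid.powers (X j))]
      at hmem
    obtain ⟨_, ⟨k, rfl⟩, hk⟩ := hmem
    exact ⟨k, hk⟩
  · rintro ⟨k, hk⟩
    have hle : genericIdeal N d ≤ RingHom.ker (solveAt N d j) :=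
      Ideal.span_le.2 (Set.range_subset_iff.2 (solveAt_genericForm j))
    have h0 : solveAt N d j (X j ^ k * t) = 0 := hle hk
    rw [map_mul, map_pow, solveAt_X] at h0
    exact (mul_eq_zero.1 h0).resolve_left (pow_ne_zero _ (toAway_X_ne_zero j j))

theorem mem_elimIdeal_iff (a : CoeffRing N d) :
    a ∈ elimIdeal N d ↔ solveAt N d j (C a) = 0 := by
  refine ⟨fun ha => (solveAt_eq_zero_iff j _).2 (ha j), fun ha i => ?_⟩
  obtain ⟨k, hk⟩ := (solveAt_eq_zero_iff j _).1 ha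
  have h0 : solveAt N d i (X j ^ k * C a) = 0 :=
    (solveAt_eq_zero_iff i _).2 ⟨0, by simpa using hk⟩
  rw [map_mul, map_pow, solveAt_X] at h0
  exact (solveAt_eq_zero_iff i _).1
    ((mul_eq_zero.1 h0).resolve_left (pow_ne_zero _ (toAway_X_ne_zero i j)))

instance elimIdeal_isPrime : (elimIdeal N d).IsPrime := by
  have hker : elimIdeal N d = RingHom.ker ((solveAt N d 0).comp C) :=
    Ideal.ext fun a => mem_elimIdeal_iff 0 a
  exact hker ▸ RingHom.ker_isPrime _

end SolveAt

section SparseForms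

variable {A L : Type*} [CommRing A] [Field L] {N d : ℕ}

/-- The exponent vector of `X_0 ^ (d - 1) * X_i`. -/
noncomputable def Mon.lin {N d : ℕ} (hd : 1 ≤ d) (i : Fin (N + 1)) : Mon N d :=
  ⟨Finsupp.single 0 (d - 1) + Finsupp.single i 1, mem_finsuppAntidiag_univ.2 (by
    rw [map_add, Finsupp.degree_single, Finsupp.degree_single, Nat.sub_add_cancel hd])⟩

theorem Mon.pure_ne_lin (hd : 1 ≤ d) {i : Fin (N + 1)} (hi : i ≠ 0) :
    Mon.pure d 0 ≠ Mon.lin hd i := fun h => by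
  simpa [Mon.lin, Mon.pure, hi.symm] using DFunLike.congr_fun (congrArg Subtype.val h) i

theorem eval_form (x : Fin (N + 1) → A) (v : Mon N d → A) :
    eval x (form v) = ∑ m, v m * eval x (monomial m.1 1) := by
  simp [form, eval_monomial]

theorem eval_monomial_pure {x : Fin (N + 1) → A} (hx : x 0 = 1) :
    eval x (monomial (Mon.pure d 0).1 1) = 1 := by
  rw [Mon.pure, ← X_pow_eq_monomial, map_pow, eval_X, hx, one_pow]

theorem eval_monomial_lin (hd : 1 ≤ d) (i : Fin (N + 1)) {x : Fin (N + 1) → A} (hx : x 0 = 1) :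
    eval x (monomial (Mon.lin hd i).1 1) = x i := by
  rw [Mon.lin, monomial_add_single, ← X_pow_eq_monomial, map_mul, map_pow, map_pow, eval_X,
    eval_X, hx, one_pow, one_mul, pow_one]

open Classical in
theorem eval_form_sub_ite_pure {x : Fin (N + 1) → A} (hx : x 0 = 1) (v : Mon N d → A) :
    eval x (form fun m => v m - if m = Mon.pure d 0 then eval x (form v) else 0) = 0 := by
  rw [eval_form]
  simp only [sub_mul, Finset.sum_sub_distrib, ← eval_form, ite_mul, zero_mul,
    Finset.sum_ite_eq', Finset.mem_univ, if_true, eval_monomial_pure hx, mul_one, sub_self]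

theorem eval_form_eq_add_of_forall_ne (hd : 1 ≤ d) {i : Fin (N + 1)} (hi : i ≠ 0)
    {x : Fin (N + 1) → A} (hx : x 0 = 1) {v : Mon N d → A}
    (hv : ∀ m, m ≠ Mon.pure d 0 → m ≠ Mon.lin hd i → v m = 0) :
    eval x (form v) = v (Mon.pure d 0) + v (Mon.lin hd i) * x i := by
  rw [eval_form, Fintype.sum_eq_add _ _ (Mon.pure_ne_lin hd hi) fun m hm => by
      rw [hv m hm.1 hm.2, zero_mul],
    eval_monomial_pure hx, eval_monomial_lin hd i hx, mul_one]

theorem exists_degeneration (hd : 1 ≤ d) {c : Fin (N + 1) × Mon N d → L}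
    (hc : ∀ i ≠ 0, c (i, Mon.lin hd i) ≠ 0) :
    ∃ (w : Fin (N + 1) × Mon N d → ℕ) (δ : Fin (N + 1) × Mon N d → Polynomial L)
      (x : Fin (N + 1) → Polynomial L), x 0 = 1 ∧
      (∀ i, eval x (form fun m => Polynomial.X ^ w (i, m) * δ (i, m)) = 0) ∧
      ∀ p ≠ (0, Mon.pure d 0), (δ p).coeff 0 = c p := by
  classical
  let w (p : Fin (N + 1) × Mon N d) : ℕ :=
    if p.1 ≠ 0 ∧ p.2 ≠ Mon.pure d 0 ∧ p.2 ≠ Mon.lin hd p.1 then 1 else 0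
  let ξ (i : Fin (N + 1)) : L := if i = 0 then 1 else -c (i, Mon.pure d 0) / c (i, Mon.lin hd i)
  let x (i : Fin (N + 1)) : Polynomial L := Polynomial.C (ξ i)
  let v (i : Fin (N + 1)) (m : Mon N d) : Polynomial L :=
    Polynomial.X ^ w (i, m) * Polynomial.C (c (i, m))
  have hx : x 0 = 1 := by simp [x, ξ]
  have hw (i) : w (i, Mon.pure d 0) = 0 := by simp [w]
  refine ⟨w, fun p => Polynomial.C (c p) - if p.2 = Mon.pure d 0 then eval x (form (v p.1)) else 0,
    x, hx, fun i => ?_, fun p hp => ?_⟩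
  · refine .trans (congrArg (fun u => eval x (form u)) (funext fun m => ?_))
      (eval_form_sub_ite_pure hx (v i))
    by_cases hm : m = Mon.pure d 0
    · simp [v, hm, hw]
    · simp [v, hm]
  · obtain ⟨i, m⟩ := p
    by_cases hm : m = Mon.pure d 0
    · have hi : i ≠ 0 := fun hi => hp (by rw [hi, hm])
      have h0 : (eval x (form (v i))).coeff 0 = 0 := by
        rw [Polynomial.coeff_zero_eq_eval_zero, ← Polynomial.coe_evalRingHom, map_eval, map_form,
          eval_form_eq_add_of_forall_ne hd hi]
        · simp [v, x, ξ, w, hi, mul_div_cancel₀ _ (hc i hi)]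
        · simp [x, ξ]
        · intro m hm hml
          simp [v, w, hi, hm, hml]
      simp [hm, h0]
    · simp [hm]

theorem elimIdeal_isPrincipal (hd : 1 ≤ d) : (elimIdeal N d).IsPrincipal := by
  -- `L` is kept opaque: unification unfolds the `ℤ`-algebra structure of a concrete fraction field.
  obtain ⟨L, _, _, _⟩ : ∃ (L : Type) (_ : Field L) (_ : Algebra (CoeffRing N d) L),
      IsFractionRing (CoeffRing N d) L :=
    ⟨FractionRing (CoeffRing N d), inferInstance, inferInstance, inferInstance⟩
  have hc := (algebraicIndependent_X (Fin (N + 1) × Mon N d) ℤ).map'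
    (f := IsScalarTower.toAlgHom ℤ (CoeffRing N d) L) (IsFractionRing.injective _ _)
  obtain ⟨w, δ, x, hx, hzero, hδ⟩ := exists_degeneration hd fun i _ => hc.ne_zero (i, Mon.lin hd i)
  have hx0 : x 0 ∈ nonZeroDivisors (Polynomial L) := hx ▸ one_mem _
  exact isPrincipal_of_degeneration _ _ hc hδ fun a ha =>
    specialize_eq_zero_of_mem_elimIdeal ha ⟨0, hx0⟩ hzero

end SparseForms

section Resultant

variable {A : Type*} [CommRing A] {N d : ℕ}

/-- The coefficients of the forms `Ψ_0, …, Ψ_N` of degree `d`. -/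
def formCoeff (d : ℕ) (Ψ : Fin (N + 1) → MvPolynomial (Fin (N + 1)) A)
    (p : Fin (N + 1) × Mon N d) : A :=
  (Ψ p.1).coeff p.2.1

theorem form_formCoeff {Ψ : Fin (N + 1) → MvPolynomial (Fin (N + 1)) A}
    (hΨ : ∀ i, (Ψ i).IsHomogeneous d) (i : Fin (N + 1)) :
    form (fun m => formCoeff d Ψ (i, m)) = Ψ i :=
  form_eq_of_isHomogeneous (hΨ i) fun _ => rfl

theorem resultant_eq_specialize (Ψ : Fin (N + 1) → MvPolynomial (Fin (N + 1)) A) :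
    resultant d Ψ = specialize (formCoeff d Ψ) (resultantPoly N d) :=
  rfl

theorem specialize_formCoeff_X_pow (a : CoeffRing N d) :
    specialize (formCoeff d fun i => (X i ^ d : MvPolynomial (Fin (N + 1)) A)) a =
      Int.castRingHom A (eval (purePowerCoeff N d) a) := by
  suffices h : specialize (formCoeff d fun i => (X i ^ d : MvPolynomial (Fin (N + 1)) A)) =
      (Int.castRingHom A).comp (eval (purePowerCoeff N d)) from DFunLike.congr_fun h a
  refine ringHom_ext' (RingHom.ext_int _ _) fun p => ?_
  simp [formCoeff, purePowerCoeff, coeff_X_pow, eq_comm]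

theorem isUnit_eval_purePowerCoeff {R : CoeffRing N d} (hR : Ideal.span {R} = elimIdeal N d) :
    IsUnit (eval (purePowerCoeff N d) R) := by
  by_contra hu
  obtain ⟨q, hq, hqR⟩ := Nat.exists_prime_and_dvd (mt Int.isUnit_iff_natAbs_eq.2 hu)
  have : Fact q.Prime := ⟨hq⟩
  let Ψ (i : Fin (N + 1)) : MvPolynomial (Fin (N + 1)) (ZMod q) := X i ^ d
  obtain ⟨a, ha, ha0⟩ : ∃ a ∈ elimIdeal N d, specialize (formCoeff d Ψ) a ≠ 0 := by
    have hΨ (i) : (Ψ i).IsHomogeneous d := isHomogeneous_X_pow i d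
    refine exists_mem_elimIdeal_specialize_ne_zero fun j => ?_
    simp only [form_formCoeff hΨ]
    exact ⟨d, Ideal.subset_span ⟨j, rfl⟩⟩
  have hR0 : specialize (formCoeff d Ψ) R = 0 := by
    rw [specialize_formCoeff_X_pow, eq_intCast, ZMod.intCast_zmod_eq_zero_iff_dvd]
    exact Int.natCast_dvd.2 hqR
  rw [← hR, Ideal.mem_span_singleton] at ha
  exact ha0 (zero_dvd_iff.1 (hR0 ▸ map_dvd _ ha))

theorem exists_isMacaulayResultant (hd : 1 ≤ d) : ∃ R, IsMacaulayResultant N d R := by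
  obtain ⟨R, hR⟩ := elimIdeal_isPrincipal (N := N) hd
  have hspan : Ideal.span {R} = elimIdeal N d := hR.symm
  rcases Int.isUnit_iff.1 (isUnit_eval_purePowerCoeff hspan) with h | h
  · exact ⟨R, hspan, h⟩
  · exact ⟨-R, by rw [Ideal.span_singleton_neg, hspan], by rw [map_neg, h, neg_neg]⟩

theorem isMacaulayResultant_resultantPoly (hd : 1 ≤ d) :
    IsMacaulayResultant N d (resultantPoly N d) :=
  Classical.epsilon_spec (exists_isMacaulayResultant hd)

theorem resultantPoly_mem_elimIdeal (hd : 1 ≤ d) : resultantPoly N d ∈ elimIdeal N d :=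
  (isMacaulayResultant_resultantPoly hd).1 ▸ Ideal.mem_span_singleton_self _

theorem resultant_ne_zero {k : Type*} [Field k] (hd : 1 ≤ d)
    {Ψ : Fin (N + 1) → MvPolynomial (Fin (N + 1)) k} (hΨ : ∀ i, (Ψ i).IsHomogeneous d)
    (hX : ∀ j, X j ∈ (Ideal.span (Set.range Ψ)).radical) : resultant d Ψ ≠ 0 := by
  obtain ⟨a, ha, ha0⟩ : ∃ a ∈ elimIdeal N d, specialize (formCoeff d Ψ) a ≠ 0 :=
    exists_mem_elimIdeal_specialize_ne_zero <| by simpa only [form_formCoeff hΨ] using hX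
  rw [← (isMacaulayResultant_resultantPoly hd).1, Ideal.mem_span_singleton] at ha
  rw [resultant_eq_specialize]
  exact fun h => ha0 (zero_dvd_iff.1 (h ▸ map_dvd (specialize (formCoeff d Ψ)) ha))

end Resultant

section Lifts

variable {K : Type*} [NontriviallyNormedField K] {N d : ℕ}
  {φ : ℙ K (Fin (N + 1) → K) → ℙ K (Fin (N + 1) → K)}
  {Φ Ψ : Fin (N + 1) → MvPolynomial (Fin (N + 1)) K}

theorem eval_smul_of_isHomogeneous {σ A : Type*} [CommRing A] {P : MvPolynomial σ A}
    (hP : P.IsHomogeneous d) (c : A) (x : σ → A) : eval (c • x) P = c ^ d * eval x P := by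
  rw [eval_eq, eval_eq, Finset.mul_sum]
  refine Finset.sum_congr rfl fun m hm => ?_
  have hm : m.degree = d := not_imp_comm.1 hP.coeff_eq_zero (mem_support_iff.1 hm)
  simp only [Pi.smul_apply, smul_eq_mul, mul_pow, Finset.prod_mul_distrib,
    Finset.prod_pow_eq_pow_sum, ← Finsupp.degree_apply, hm]
  ring

theorem polyMap_apply_smul (hΦ : ∀ i, (Φ i).IsHomogeneous d) (c : K) (x : Fin (N + 1) → K) :
    polyMap Φ (c • x) = c ^ d • polyMap Φ x :=
  funext fun i => eval_smul_of_isHomogeneous (hΦ i) c x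

theorem polyMap_smul (c : K) (Φ : Fin (N + 1) → MvPolynomial (Fin (N + 1)) K)
    (x : Fin (N + 1) → K) : polyMap (c • Φ) x = c • polyMap Φ x :=
  funext fun i => smul_eval x (Φ i) c

theorem X_mem_radical_span_of_forall_polyMap_ne_zero [IsAlgClosed K]
    (hΨ : ∀ x : Fin (N + 1) → K, x ≠ 0 → polyMap Ψ x ≠ 0) (j : Fin (N + 1)) :
    X j ∈ (Ideal.span (Set.range Ψ)).radical := by
  rw [← vanishingIdeal_zeroLocus_eq_radical (K := K), mem_vanishingIdeal_iff, zeroLocus_span]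
  intro x hx
  have hx0 : x = 0 := by_contra fun h => hΨ x h (funext fun i => hx _ ⟨i, rfl⟩)
  rw [aeval_X, hx0, Pi.zero_apply]

theorem IsLift.ne_zero_lift (hΦ : IsLift d φ Φ) : Φ ≠ 0 := by
  rintro rfl
  exact hΦ.ne_zero 1 one_ne_zero (funext fun _ => map_zero _)

theorem IsLift.resultant_ne_zero [IsAlgClosed K] (hd : 1 ≤ d) (hΨ : IsLift d φ Ψ) :
    resultant d Ψ ≠ 0 :=
  NonarchGreen.resultant_ne_zero hd hΨ.isHomogeneous
    (X_mem_radical_span_of_forall_polyMap_ne_zero hΨ.ne_zero)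

theorem IsLift.smul (hΦ : IsLift d φ Φ) {c : K} (hc : c ≠ 0) : IsLift d φ (c • Φ) where
  isHomogeneous i := (homogeneousSubmodule _ _ d).smul_mem c (hΦ.isHomogeneous i)
  ne_zero x hx := by
    rw [polyMap_smul]
    exact smul_ne_zero hc (hΦ.ne_zero x hx)
  map_mk x hx := by
    rw [hΦ.map_mk x hx, Projectivization.mk_eq_mk_iff']
    exact ⟨c⁻¹, by rw [polyMap_smul, inv_smul_smul₀ hc]⟩

theorem IsLift.mul_eq_mul (hd : 1 ≤ d) (hΦ : IsLift d φ Φ) (hΨ : IsLift d φ Ψ)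
    (i l : Fin (N + 1)) : Φ i * Ψ l = Φ l * Ψ i := by
  refine MvPolynomial.funext fun x => ?_
  rw [map_mul, map_mul]
  rcases eq_or_ne x 0 with rfl | hx
  · have h0 (i) : eval 0 (Φ i) = 0 := by
      simpa [Nat.ne_of_gt hd] using eval_smul_of_isHomogeneous (hΦ.isHomogeneous i) 0 0
    rw [h0, h0, zero_mul, zero_mul]
  · obtain ⟨c, hc⟩ := (Projectivization.mk_eq_mk_iff' ..).1
      ((hΦ.map_mk x hx).symm.trans (hΨ.map_mk x hx))
    have hc (i) : eval x (Φ i) = c * eval x (Ψ i) := (congrFun hc i).symm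
    rw [hc, hc, mul_right_comm]

theorem IsLift.exists_eq_smul [IsAlgClosed K] (hd : 1 ≤ d) (hΦ : IsLift d φ Φ)
    (hΨ : IsLift d φ Ψ) : ∃ c : K, c ≠ 0 ∧ Φ = c • Ψ := by
  obtain ⟨c, hc⟩ := exists_eq_smul_of_mul_eq_mul hΦ.isHomogeneous hΨ.isHomogeneous
    (X_mem_radical_span_of_forall_polyMap_ne_zero hΨ.ne_zero) hΨ.ne_zero_lift (hΦ.mul_eq_mul hd hΨ)
  refine ⟨c, ?_, hc⟩
  rintro rfl
  exact hΦ.ne_zero_lift (hc.trans (zero_smul K Ψ))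

theorem IsLift.gFun_mk (hd : 1 ≤ d) (hΦ : IsLift d φ Φ) (x : Fin (N + 1) → K) (hx : x ≠ 0) :
    gFun d Φ (Projectivization.mk K x hx) =
      1 / (d : ℝ) * Real.log ‖polyMap Φ x‖ - Real.log ‖x‖ := by
  obtain ⟨a, ha⟩ := Projectivization.exists_smul_eq_mk_rep K x hx
  have ha0 : ‖(a : K)‖ ≠ 0 := norm_ne_zero_iff.2 a.ne_zero
  have hd0 : (d : ℝ) ≠ 0 := by positivity
  rw [gFun, ← ha, Units.smul_def, polyMap_apply_smul hΦ.isHomogeneous, norm_smul, norm_smul,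
    norm_pow, Real.log_mul (pow_ne_zero _ ha0) (norm_ne_zero_iff.2 (hΦ.ne_zero x hx)),
    Real.log_mul ha0 (norm_ne_zero_iff.2 hx), Real.log_pow]
  field_simp
  ring

theorem IsLift.gFun_smul (hΨ : IsLift d φ Ψ) {c : K} (hc : c ≠ 0) (P : ℙ K (Fin (N + 1) → K)) :
    gFun d (c • Ψ) P = gFun d Ψ P + 1 / (d : ℝ) * Real.log ‖c‖ := by
  rw [gFun, gFun, polyMap_smul, norm_smul, Real.log_mul (norm_ne_zero_iff.2 hc)
    (norm_ne_zero_iff.2 (hΨ.ne_zero _ P.rep_nonzero))]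
  ring

theorem IsLift.gFun_sub_gFun_eq [IsAlgClosed K] (hd : 1 ≤ d) (hΦ : IsLift d φ Φ)
    (hΨ : IsLift d φ Ψ) (P Q : ℙ K (Fin (N + 1) → K)) :
    gFun d Φ P - gFun d Φ Q = gFun d Ψ P - gFun d Ψ Q := by
  obtain ⟨c, hc, rfl⟩ := hΦ.exists_eq_smul hd hΨ
  rw [hΨ.gFun_smul hc, hΨ.gFun_smul hc, add_sub_add_right_eq_sub]

theorem IsLift.exists_norm_coeff_le (hΦ : IsLift d φ Φ) :
    ∃ i₀ m₀, (Φ i₀).coeff m₀ ≠ 0 ∧ ∀ i m, ‖(Φ i).coeff m‖ ≤ ‖(Φ i₀).coeff m₀‖ := by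
  have : Nonempty (Fin (N + 1) × Mon N d) := ⟨(0, Mon.pure d 0)⟩
  obtain ⟨⟨i₀, m₀⟩, hmax⟩ := Finite.exists_max fun p : Fin (N + 1) × Mon N d => ‖formCoeff d Φ p‖
  have hle (i m) : ‖(Φ i).coeff m‖ ≤ ‖(Φ i₀).coeff m₀.1‖ := by
    by_cases hm : m.degree = d
    · exact hmax (i, ⟨m, mem_finsuppAntidiag_univ.2 hm⟩)
    · rw [(hΦ.isHomogeneous i).coeff_eq_zero hm, norm_zero]
      exact norm_nonneg _
  refine ⟨i₀, m₀, fun h0 => hΦ.ne_zero_lift (funext fun i => MvPolynomial.ext _ _ fun m => ?_), hle⟩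
  simpa [h0] using hle i m

theorem IsLift.exists_isMinimalLift (hΦ : IsLift d φ Φ) : ∃ Ψ, IsMinimalLift d φ Ψ := by
  obtain ⟨i₀, m₀, hb, hle⟩ := hΦ.exists_norm_coeff_le
  refine ⟨((Φ i₀).coeff m₀)⁻¹ • Φ, hΦ.smul (inv_ne_zero hb), fun i m => ?_, i₀, m₀, ?_⟩
  · rw [Pi.smul_apply, coeff_smul, norm_smul, norm_inv]
    exact inv_mul_le_one_of_le₀ (hle i m) (norm_nonneg _)
  · rw [Pi.smul_apply, coeff_smul, smul_eq_mul, inv_mul_cancel₀ hb, norm_one]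

theorem IsMinimalResultant.ne_zero {ρ : K} [IsAlgClosed K] (hd : 1 ≤ d)
    (hρ : IsMinimalResultant d φ ρ) : ρ ≠ 0 := by
  obtain ⟨Ψ, hΨ, rfl⟩ := hρ
  exact hΨ.resultant_ne_zero hd

end Lifts

section Sphere

variable {K : Type*} [NontriviallyNormedField K] {N : ℕ}

theorem exists_norm_apply_eq_norm (x : Fin (N + 1) → K) : ∃ i, ‖x i‖ = ‖x‖ := by
  obtain ⟨i, hi⟩ := Finite.exists_max fun j => ‖x j‖
  exact ⟨i, (norm_le_pi_norm x i).antisymm ((pi_norm_le_iff_of_nonempty x).2 hi)⟩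

theorem exists_mk_eq_norm_eq_one (P : ℙ K (Fin (N + 1) → K)) :
    ∃ (x : Fin (N + 1) → K) (hx : x ≠ 0) (i : Fin (N + 1)),
      P = Projectivization.mk K x hx ∧ ‖x‖ = 1 ∧ x i = 1 := by
  obtain ⟨i, hi⟩ := exists_norm_apply_eq_norm P.rep
  have hP : ‖P.rep‖ ≠ 0 := norm_ne_zero_iff.2 P.rep_nonzero
  have h0 : P.rep i ≠ 0 := norm_ne_zero_iff.1 (hi ▸ hP)
  refine ⟨(P.rep i)⁻¹ • P.rep, smul_ne_zero (inv_ne_zero h0) P.rep_nonzero, i, ?_, ?_, ?_⟩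
  · conv_lhs => rw [← P.mk_rep]
    rw [Projectivization.mk_eq_mk_iff']
    exact ⟨P.rep i, smul_inv_smul₀ h0 _⟩
  · rw [norm_smul, norm_inv, hi, inv_mul_cancel₀ hP]
  · rw [Pi.smul_apply, smul_eq_mul, inv_mul_cancel₀ h0]

theorem chordalDist_nonneg (P Q : ℙ K (Fin (N + 1) → K)) : 0 ≤ chordalDist P Q :=
  div_nonneg (Real.iSup_nonneg fun _ => norm_nonneg _) (by positivity)

theorem norm_sub_le_chordalDist_mk {x y : Fin (N + 1) → K} (hx : x ≠ 0) (hy : y ≠ 0)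
    (hx1 : ‖x‖ = 1) (hy1 : ‖y‖ = 1) (i j : Fin (N + 1)) :
    ‖x i * y j - x j * y i‖ ≤
      chordalDist (Projectivization.mk K x hx) (Projectivization.mk K y hy) := by
  rw [chordalDist_mk, hx1, hy1, mul_one, div_one]
  exact le_ciSup (f := fun p : Fin (N + 1) × Fin (N + 1) => ‖x p.1 * y p.2 - x p.2 * y p.1‖)
    (Set.finite_range _).bddAbove (i, j)

theorem exists_mk_eq_norm_sub_le [IsUltrametricDist K] {P Q : ℙ K (Fin (N + 1) → K)}
    (h : chordalDist P Q < 1) :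
    ∃ (x y : Fin (N + 1) → K) (hx : x ≠ 0) (hy : y ≠ 0), P = Projectivization.mk K x hx ∧
      Q = Projectivization.mk K y hy ∧ ‖x‖ = 1 ∧ ‖y‖ = 1 ∧ ‖x - y‖ ≤ chordalDist P Q := by
  obtain ⟨x, hx, i, rfl, hx1, hxi⟩ := exists_mk_eq_norm_eq_one P
  obtain ⟨y, hy, j, rfl, hy1, hyj⟩ := exists_mk_eq_norm_eq_one Q
  have hD := norm_sub_le_chordalDist_mk hx hy hx1 hy1
  have hyi : ‖y i‖ = 1 := by
    have hlt : ‖1 + -(x j * y i)‖ < max ‖(1 : K)‖ ‖-(x j * y i)‖ := by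
      rw [← sub_eq_add_neg, norm_one]
      simpa only [hxi, hyj, one_mul] using ((hD i j).trans_lt h).trans_le (le_max_left _ _)
    have hxy : 1 = ‖x j‖ * ‖y i‖ := by
      simpa using IsUltrametricDist.norm_eq_of_add_norm_lt_max hlt
    refine (hy1 ▸ norm_le_pi_norm y i).antisymm (hxy.trans_le ?_)
    exact mul_le_of_le_one_left (norm_nonneg _) (hx1 ▸ norm_le_pi_norm x j)
  have hyi0 : y i ≠ 0 := norm_ne_zero_iff.1 (hyi ▸ one_ne_zero)
  refine ⟨x, (y i)⁻¹ • y, hx, smul_ne_zero (inv_ne_zero hyi0) hy, rfl, ?_, hx1, ?_, ?_⟩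
  · rw [Projectivization.mk_eq_mk_iff']
    exact ⟨y i, smul_inv_smul₀ hyi0 _⟩
  · rw [norm_smul, norm_inv, hyi, hy1, inv_one, one_mul]
  · refine (pi_norm_le_iff_of_nonempty _).2 fun l => ?_
    calc ‖(x - (y i)⁻¹ • y) l‖ = ‖(y i)⁻¹ * (x l * y i - x i * y l)‖ := by
          rw [hxi, Pi.sub_apply, Pi.smul_apply, smul_eq_mul]
          field_simp
      _ = ‖x l * y i - x i * y l‖ := by rw [norm_mul, norm_inv, hyi, inv_one, one_mul]
      _ ≤ _ := hD l i

end Sphere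

section Integral

variable {K σ : Type*} [NontriviallyNormedField K] [IsUltrametricDist K] {x y : σ → K}

theorem norm_eval₂_le_one {R : Type*} [CommRing R] {f : R →+* K} (hf : ∀ r, ‖f r‖ ≤ 1)
    (hx : ∀ i, ‖x i‖ ≤ 1) (P : MvPolynomial σ R) : ‖eval₂ f x P‖ ≤ 1 := by
  induction P using MvPolynomial.induction_on with
  | C r => simpa only [eval₂_C] using hf r
  | add p q hp hq =>
    rw [eval₂_add]
    exact (IsUltrametricDist.norm_add_le_max _ _).trans (max_le hp hq)
  | mul_X p i hp =>
    rw [eval₂_mul, eval₂_X, norm_mul]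
    exact mul_le_one₀ hp (norm_nonneg _) (hx i)

theorem norm_eval₂_sub_eval₂_le {R : Type*} [CommRing R] {f : R →+* K} (hf : ∀ r, ‖f r‖ ≤ 1)
    (hx : ∀ i, ‖x i‖ ≤ 1) (hy : ∀ i, ‖y i‖ ≤ 1) {r : ℝ} (hr : 0 ≤ r)
    (hxy : ∀ i, ‖x i - y i‖ ≤ r) (P : MvPolynomial σ R) : ‖eval₂ f x P - eval₂ f y P‖ ≤ r := by
  induction P using MvPolynomial.induction_on with
  | C a => simpa only [eval₂_C, sub_self, norm_zero] using hr
  | add p q hp hq =>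
    rw [eval₂_add, eval₂_add, add_sub_add_comm]
    exact (IsUltrametricDist.norm_add_le_max _ _).trans (max_le hp hq)
  | mul_X p i hp =>
    have hsplit : eval₂ f x (p * X i) - eval₂ f y (p * X i) =
        eval₂ f x p * (x i - y i) + (eval₂ f x p - eval₂ f y p) * y i := by
      rw [eval₂_mul, eval₂_mul, eval₂_X, eval₂_X]
      ring
    rw [hsplit]
    refine (IsUltrametricDist.norm_add_le_max _ _).trans (max_le ?_ ?_) <;> rw [norm_mul]
    · exact (mul_le_of_le_one_left (norm_nonneg _) (norm_eval₂_le_one hf hx p)).trans (hxy i)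
    · exact (mul_le_of_le_one_right (norm_nonneg _) (hy i)).trans hp

theorem exists_map_subtype_eq_of_norm_coeff_le_one {P : MvPolynomial σ K}
    (hP : ∀ m, ‖P.coeff m‖ ≤ 1) :
    ∃ p, map (NormedField.valuation (K := K)).integer.subtype p = P := by
  refine mem_range_map_iff_coeffs_subset.2 fun c hc => ?_
  obtain ⟨m, -, rfl⟩ := mem_coeffs_iff.1 hc
  exact ⟨⟨_, hP m⟩, rfl⟩

theorem norm_eval_le_one {P : MvPolynomial σ K} (hP : ∀ m, ‖P.coeff m‖ ≤ 1)
    (hx : ∀ i, ‖x i‖ ≤ 1) : ‖eval x P‖ ≤ 1 := by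
  obtain ⟨p, rfl⟩ := exists_map_subtype_eq_of_norm_coeff_le_one hP
  rw [eval_map]
  exact norm_eval₂_le_one Subtype.prop hx p

theorem norm_eval_sub_eval_le {P : MvPolynomial σ K} (hP : ∀ m, ‖P.coeff m‖ ≤ 1)
    (hx : ∀ i, ‖x i‖ ≤ 1) (hy : ∀ i, ‖y i‖ ≤ 1) {r : ℝ} (hr : 0 ≤ r)
    (hxy : ∀ i, ‖x i - y i‖ ≤ r) : ‖eval x P - eval y P‖ ≤ r := by
  obtain ⟨p, rfl⟩ := exists_map_subtype_eq_of_norm_coeff_le_one hP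
  rw [eval_map, eval_map]
  exact norm_eval₂_sub_eval₂_le Subtype.prop hx hy hr hxy p

end Integral

section GreenFunction

variable {K : Type*} [NontriviallyNormedField K] [IsUltrametricDist K] {N d : ℕ}
  {φ : ℙ K (Fin (N + 1) → K) → ℙ K (Fin (N + 1) → K)}
  {Ψ : Fin (N + 1) → MvPolynomial (Fin (N + 1)) K} {x y : Fin (N + 1) → K}

theorem norm_polyMap_le_one (hΨ : ∀ i m, ‖(Ψ i).coeff m‖ ≤ 1) (hx : ‖x‖ ≤ 1) :
    ‖polyMap Ψ x‖ ≤ 1 :=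
  (pi_norm_le_iff_of_nonempty _).2 fun i =>
    norm_eval_le_one (hΨ i) ((pi_norm_le_iff_of_nonempty x).1 hx)

theorem norm_polyMap_sub_polyMap_le (hΨ : ∀ i m, ‖(Ψ i).coeff m‖ ≤ 1) (hx : ‖x‖ ≤ 1)
    (hy : ‖y‖ ≤ 1) : ‖polyMap Ψ x - polyMap Ψ y‖ ≤ ‖x - y‖ :=
  (pi_norm_le_iff_of_nonempty _).2 fun i =>
    norm_eval_sub_eval_le (hΨ i) ((pi_norm_le_iff_of_nonempty x).1 hx)
      ((pi_norm_le_iff_of_nonempty y).1 hy) (norm_nonneg _) (norm_le_pi_norm (x - y))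

theorem norm_specialize_le_one {γ : Fin (N + 1) × Mon N d → K} (hγ : ∀ p, ‖γ p‖ ≤ 1)
    (a : CoeffRing N d) : ‖specialize γ a‖ ≤ 1 :=
  norm_eval₂_le_one (fun n => by simpa using IsUltrametricDist.norm_intCast_le_one K n) hγ a

theorem norm_resultant_le_norm_polyMap (hd : 1 ≤ d) (hhom : ∀ i, (Ψ i).IsHomogeneous d)
    (hint : ∀ i m, ‖(Ψ i).coeff m‖ ≤ 1) (hx : ‖x‖ = 1) :
    ‖resultant d Ψ‖ ≤ ‖polyMap Ψ x‖ := by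
  let f := specialize (formCoeff d Ψ)
  have hf (a) : ‖f a‖ ≤ 1 := norm_specialize_le_one (fun p => hint _ _) a
  have hF (i) : eval₂ f x (genericForm N d i) = polyMap Ψ x i := by
    rw [← eval_map, map_specialize_genericForm, form_formCoeff hhom]
    rfl
  obtain ⟨j, hj⟩ := exists_norm_apply_eq_norm x
  obtain ⟨k, hk⟩ := resultantPoly_mem_elimIdeal hd j
  obtain ⟨h, hsum⟩ := Ideal.mem_span_range_iff_exists_fun.1 hk
  have hres : ∑ i, eval₂ f x (h i) * polyMap Ψ x i = x j ^ k * f (resultantPoly N d) := by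
    have := congrArg (eval₂Hom f x) hsum
    simpa only [map_sum, map_mul, map_pow, coe_eval₂Hom, eval₂_X, eval₂_C, hF] using this
  calc ‖resultant d Ψ‖ = ‖∑ i, eval₂ f x (h i) * polyMap Ψ x i‖ := by
        rw [resultant_eq_specialize, hres, norm_mul, norm_pow, hj, hx, one_pow, one_mul]
    _ ≤ ‖polyMap Ψ x‖ := by
        refine IsUltrametricDist.norm_sum_le_of_forall_le_of_nonneg (norm_nonneg _) fun i _ => ?_
        rw [norm_mul]
        exact (mul_le_of_le_one_left (norm_nonneg _)
          (norm_eval₂_le_one hf ((pi_norm_le_iff_of_nonempty x).1 hx.le) _)).trans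
          (norm_le_pi_norm (polyMap Ψ x) i)

theorem norm_resultant_le_one (hd : 1 ≤ d) (hhom : ∀ i, (Ψ i).IsHomogeneous d)
    (hint : ∀ i m, ‖(Ψ i).coeff m‖ ≤ 1) : ‖resultant d Ψ‖ ≤ 1 :=
  have h1 : ‖(1 : Fin (N + 1) → K)‖ = 1 := norm_one
  (norm_resultant_le_norm_polyMap hd hhom hint h1).trans (norm_polyMap_le_one hint h1.le)

theorem norm_polyMap_eq_of_norm_sub_lt (hd : 1 ≤ d) (hhom : ∀ i, (Ψ i).IsHomogeneous d)
    (hint : ∀ i m, ‖(Ψ i).coeff m‖ ≤ 1) (hx : ‖x‖ = 1) (hy : ‖y‖ = 1)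
    (hxy : ‖x - y‖ < ‖resultant d Ψ‖) : ‖polyMap Ψ x‖ = ‖polyMap Ψ y‖ := by
  have hlt : ‖polyMap Ψ x + -polyMap Ψ y‖ < max ‖polyMap Ψ x‖ ‖-polyMap Ψ y‖ := by
    rw [← sub_eq_add_neg]
    calc _ ≤ ‖x - y‖ := norm_polyMap_sub_polyMap_le hint hx.le hy.le
      _ < ‖resultant d Ψ‖ := hxy
      _ ≤ ‖polyMap Ψ x‖ := norm_resultant_le_norm_polyMap hd hhom hint hx
      _ ≤ _ := le_max_left _ _
  simpa only [norm_neg] using IsUltrametricDist.norm_eq_of_add_norm_lt_max hlt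

theorem IsLift.gFun_eq_of_chordalDist_lt (hd : 1 ≤ d) (hΨ : IsLift d φ Ψ)
    (hint : ∀ i m, ‖(Ψ i).coeff m‖ ≤ 1) {P Q : ℙ K (Fin (N + 1) → K)}
    (h : chordalDist P Q < ‖resultant d Ψ‖) : gFun d Ψ P = gFun d Ψ Q := by
  have hρ := norm_resultant_le_one hd hΨ.isHomogeneous hint
  obtain ⟨x, y, hx, hy, hP, hQ, hx1, hy1, hxy⟩ := exists_mk_eq_norm_sub_le (h.trans_le hρ)
  rw [hP, hQ, hΨ.gFun_mk hd, hΨ.gFun_mk hd, hx1, hy1,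
    norm_polyMap_eq_of_norm_sub_lt hd hΨ.isHomogeneous hint hx1 hy1 (hxy.trans_lt h)]

theorem IsLift.gFun_mem_Icc (hd : 1 ≤ d) (hΨ : IsLift d φ Ψ)
    (hint : ∀ i m, ‖(Ψ i).coeff m‖ ≤ 1) (hρ : resultant d Ψ ≠ 0) (P : ℙ K (Fin (N + 1) → K)) :
    gFun d Ψ P ∈ Set.Icc (Real.log ‖resultant d Ψ‖ / d) 0 := by
  obtain ⟨x, hx, -, rfl, hx1, -⟩ := exists_mk_eq_norm_eq_one P
  rw [hΨ.gFun_mk hd, hx1, Real.log_one, sub_zero, one_div_mul_eq_div]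
  constructor
  · have := norm_pos_iff.2 hρ
    gcongr
    exact norm_resultant_le_norm_polyMap hd hΨ.isHomogeneous hint hx1
  · exact div_nonpos_of_nonpos_of_nonneg
      (Real.log_nonpos (norm_nonneg _) (norm_polyMap_le_one hint hx1.le)) d.cast_nonneg

theorem IsLift.abs_gFun_sub_gFun_le (hd : 1 ≤ d) (hΨ : IsLift d φ Ψ)
    (hint : ∀ i m, ‖(Ψ i).coeff m‖ ≤ 1) (hρ : resultant d Ψ ≠ 0)
    (P Q : ℙ K (Fin (N + 1) → K)) :
    |gFun d Ψ P - gFun d Ψ Q| ≤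
      Real.log (‖resultant d Ψ‖⁻¹) / (d * ‖resultant d Ψ‖) * chordalDist P Q := by
  obtain ⟨hP, hP'⟩ := hΨ.gFun_mem_Icc hd hint hρ P
  obtain ⟨hQ, hQ'⟩ := hΨ.gFun_mem_Icc hd hint hρ Q
  have hosc : |gFun d Ψ P - gFun d Ψ Q| ≤ Real.log (‖resultant d Ψ‖⁻¹) / d := by
    rw [Real.log_inv, neg_div, abs_le]
    constructor <;> linarith
  rw [← div_div, div_mul_eq_mul_div, mul_div_assoc]
  rcases lt_or_ge (chordalDist P Q) ‖resultant d Ψ‖ with h | h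
  · rw [hΨ.gFun_eq_of_chordalDist_lt hd hint h, sub_self, abs_zero]
    exact mul_nonneg ((abs_nonneg _).trans hosc)
      (div_nonneg (chordalDist_nonneg P Q) (norm_nonneg _))
  · exact hosc.trans (le_mul_of_one_le_right ((abs_nonneg _).trans hosc)
      ((one_le_div (norm_pos_iff.2 hρ)).2 h))

variable {Φ : Fin (N + 1) → MvPolynomial (Fin (N + 1)) K} {ρ : K}

theorem IsMinimalResultant.norm_le_one (hd : 1 ≤ d) (hρ : IsMinimalResultant d φ ρ) :
    ‖ρ‖ ≤ 1 := by
  obtain ⟨Ψ, hΨ, rfl⟩ := hρ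
  exact norm_resultant_le_one hd hΨ.isHomogeneous hΨ.integral

theorem IsMinimalResultant.abs_gFun_sub_gFun_le [IsAlgClosed K] (hd : 1 ≤ d)
    (hρ : IsMinimalResultant d φ ρ) (hΦ : IsLift d φ Φ) (P Q : ℙ K (Fin (N + 1) → K)) :
    |gFun d Φ P - gFun d Φ Q| ≤ Real.log (‖ρ‖⁻¹) / (d * ‖ρ‖) * chordalDist P Q := by
  obtain ⟨Ψ, hΨ, rfl⟩ := hρ
  rw [hΦ.gFun_sub_gFun_eq hd hΨ.toIsLift]
  exact hΨ.toIsLift.abs_gFun_sub_gFun_le hd hΨ.integral (hΨ.resultant_ne_zero hd) P Q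

theorem IsMinimalResultant.gFun_eq_of_chordalDist_lt [IsAlgClosed K] (hd : 1 ≤ d)
    (hρ : IsMinimalResultant d φ ρ) (hΦ : IsLift d φ Φ) {P Q : ℙ K (Fin (N + 1) → K)}
    (h : chordalDist P Q < ‖ρ‖) : gFun d Φ P = gFun d Φ Q := by
  obtain ⟨Ψ, hΨ, rfl⟩ := hρ
  rw [← sub_eq_zero, hΦ.gFun_sub_gFun_eq hd hΨ.toIsLift, sub_eq_zero]
  exact hΨ.toIsLift.gFun_eq_of_chordalDist_lt hd hΨ.integral h

end GreenFunction

end NonarchGreen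

open NonarchGreen in
theorem theorem13_general {K : Type*} [NontriviallyNormedField K] [IsUltrametricDist K]
    [IsAlgClosed K] (N d : ℕ) (hd : 1 ≤ d)
    (φ : ℙ K (Fin (N + 1) → K) → ℙ K (Fin (N + 1) → K))
    (Φ : Fin (N + 1) → MvPolynomial (Fin (N + 1)) K) (hΦ : IsLift d φ Φ) :
    (∀ (x : Fin (N + 1) → K) (hx : x ≠ 0),
      gFun d Φ (Projectivization.mk K x hx) =
        1 / (d : ℝ) * Real.log ‖polyMap Φ x‖ - Real.log ‖x‖) ∧
    (∃ L : ℝ, 0 ≤ L ∧ ∀ P Q : ℙ K (Fin (N + 1) → K),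
      |gFun d Φ P - gFun d Φ Q| ≤ L * chordalDist P Q) ∧
    (∃ ρ : K, IsMinimalResultant d φ ρ) ∧
    (∀ ρ : K, IsMinimalResultant d φ ρ → ρ ≠ 0 ∧
      (∀ P Q : ℙ K (Fin (N + 1) → K),
        |gFun d Φ P - gFun d Φ Q| ≤ Real.log (‖ρ‖⁻¹) / (d * ‖ρ‖) * chordalDist P Q) ∧
      (∀ P Q : ℙ K (Fin (N + 1) → K), chordalDist P Q < ‖ρ‖ → gFun d Φ P = gFun d Φ Q)) ∧
    (∃ ε : ℝ, 0 < ε ∧ ∀ P Q : ℙ K (Fin (N + 1) → K),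
      chordalDist P Q < ε → gFun d Φ P = gFun d Φ Q) := by
  obtain ⟨Ψ, hΨ⟩ := hΦ.exists_isMinimalLift
  have hmin : IsMinimalResultant d φ (resultant d Ψ) := ⟨Ψ, hΨ, rfl⟩
  have hpos : 0 < ‖resultant d Ψ‖ := norm_pos_iff.2 (hmin.ne_zero hd)
  have hlog : 0 ≤ Real.log (‖resultant d Ψ‖⁻¹) :=
    Real.log_nonneg ((one_le_inv₀ hpos).2 (hmin.norm_le_one hd))
  refine ⟨hΦ.gFun_mk hd, ⟨_, by positivity, hmin.abs_gFun_sub_gFun_le hd hΦ⟩, ⟨_, hmin⟩,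
    fun ρ hρ => ⟨hρ.ne_zero hd, hρ.abs_gFun_sub_gFun_le hd hΦ, fun P Q h => ?_⟩,
    _, hpos, fun P Q h => ?_⟩
  · exact hρ.gFun_eq_of_chordalDist_lt hd hΦ h
  · exact hmin.gFun_eq_of_chordalDist_lt hd hΦ h

open NonarchGreen in
theorem theorem13 {K : Type*} [NontriviallyNormedField K] [IsUltrametricDist K] [CompleteSpace K]
    [IsAlgClosed K] (N d : ℕ) (hd : 2 ≤ d)
    (φ : ℙ K (Fin (N + 1) → K) → ℙ K (Fin (N + 1) → K)) (hφ : IsMorphismOfDegree d φ)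
    (Φ : Fin (N + 1) → MvPolynomial (Fin (N + 1)) K) (hΦ : IsLift d φ Φ) :
    -- `g_Φ` may be computed from any lift of the point
    (∀ (x : Fin (N + 1) → K) (hx : x ≠ 0),
      gFun d Φ (Projectivization.mk K x hx) =
        1 / (d : ℝ) * Real.log ‖polyMap Φ x‖ - Real.log ‖x‖) ∧
    -- `g_Φ` is Lipschitz continuous for the chordal metric
    (∃ L : ℝ, 0 ≤ L ∧ ∀ P Q : ℙ K (Fin (N + 1) → K),
      |gFun d Φ P - gFun d Φ Q| ≤ L * chordalDist P Q) ∧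
    -- the explicit constants; `ρ` is any minimal resultant of `φ`
    (∃ ρ : K, IsMinimalResultant d φ ρ) ∧
    (∀ ρ : K, IsMinimalResultant d φ ρ → ρ ≠ 0 ∧
      (∀ P Q : ℙ K (Fin (N + 1) → K),
        |gFun d Φ P - gFun d Φ Q| ≤ Real.log (‖ρ‖⁻¹) / (d * ‖ρ‖) * chordalDist P Q) ∧
      (∀ P Q : ℙ K (Fin (N + 1) → K), chordalDist P Q < ‖ρ‖ → gFun d Φ P = gFun d Φ Q)) ∧
    -- `g_Φ` is uniformly locally constant
    (∃ ε : ℝ, 0 < ε ∧ ∀ P Q : ℙ K (Fin (N + 1) → K),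
      chordalDist P Q < ε → gFun d Φ P = gFun d Φ Q) :=
  theorem13_general N d (by omega) φ Φ hΦ
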